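/- Let $p>2$ be a prime and let $n\ge 31$. Let $M_1,\dots,M_n$ be linearly independent symmetric $n\times n$ matrices over $\mathbb{F}_p$ such that every nonzero linear combination of $M_1,\dots,M_n$ has rank $n$. Put $Q_i(x)=x^TM_ix$ for $x\in\mathbb{F}_p^n$, and let $$\mathrm{QGS}(p,n)=\{x\in\mathbb{F}_p^n : \exists\, i\in\{1,\dots,n\}\text{ with } Q_1(x)=\dots=Q_{i-1}(x)=0 \text{ and } Q_i(x)=1\}$$ be the quadratic Green–Sanders example defined by these matrices. Then the $\mathrm{VC}_2$-dimension of $A=\mathrm{QGS}(p,n)$ is at least $3$; that is, there exist elements $x_1,x_2,x_3$, $y_1,y_2,y_3$ and $z_S$ (for each $S\subseteq\{1,2,3\}^2$) of $\mathbb{F}_p^n$ such that, for all $i,j\in\{1,2,3\}$ and all $S\subseteq\{1,2,3\}^2$, $$x_i+y_j+z_S\in A \iff (i,j)\in S.$$ -/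

import Mathlib

/-- A subset `A` of an abelian group `G` has `VC₂`-dimension at least `k`: there are elements
`x i`, `y j` (`i, j` in a `k`-element index set) and `z S` (one for each set `S` of index pairs)
such that `x i + y j + z S ∈ A` if and only if `(i, j) ∈ S`. -/
def VC2DimAtLeast {G : Type*} [AddCommGroup G] (A : Set G) (k : ℕ) : Prop :=
  ∃ (x y : Fin k → G) (z : Set (Fin k × Fin k) → G),
    ∀ (S : Set (Fin k × Fin k)) (i j : Fin k), x i + y j + z S ∈ A ↔ (i, j) ∈ S

/-- `M 0, …, M (n - 1)` is a basis of an `n`-dimensional space of symmetric `n × n` matrices over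
`F` all of whose nonzero elements have rank `n`. -/
structure IsFullRankSymmBasis {F : Type*} [Field F] {n : ℕ}
    (M : Fin n → Matrix (Fin n) (Fin n) F) : Prop where
  isSymm : ∀ i, (M i).IsSymm
  linearIndependent : LinearIndependent F M
  rank_eq : ∀ N ∈ Submodule.span F (Set.range M), N ≠ 0 → N.rank = n

/-- The quadratic form `xᵀ N x`. -/
def quadVal {F : Type*} [Field F] {n : ℕ} (N : Matrix (Fin n) (Fin n) F) (x : Fin n → F) : F :=
  x ⬝ᵥ N.mulVec x

/-- The quadratic Green-Sanders example defined by the matrices `M 0, …, M (n - 1)`: the set of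
all vectors `x` for which some `i` satisfies `xᵀ (M j) x = 0` for all `j < i` and
`xᵀ (M i) x = 1`. -/
def QGS {F : Type*} [Field F] {n : ℕ} (M : Fin n → Matrix (Fin n) (Fin n) F) :
    Set (Fin n → F) :=
  {x | ∃ i, (∀ j, j < i → quadVal (M j) x = 0) ∧ quadVal (M i) x = 1}

/-!
Only the first three forms `Q_0, Q_1, Q_2` are needed. Take `x = (0, w₀, w₁)` and `y = (0, w₂, w₃)`,
where the `wᵢ` are pairwise orthogonal for these three forms. Then
`Q_k (x i + y j + z) = α k i + β k j` is a sum of a row shift and a column shift, and the shifts are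
determined by the twelve values `wᵢᵀ M_k z` and the three values `Q_k z`. If the twelve vectors
`M_k wᵢ` are linearly independent, then all fifteen values can be prescribed: this is a Gauss sum
estimate (`norm_sum_addChar_quadratic_sq`, `exists_bilin_eq_and_quad_eq`), whose error term is
controlled as soon as `15 + n / 2 < n`, that is, `n > 30`. Such `wᵢ` are found greedily by counting
(`exists_isotropic`), and so `exists_quadVal_add_eq` realizes arbitrary shifts `α` and `β`.

What is left is combinatorial (`exists_additive`): for each `3 × 3` pattern of Booleans there are
integer shifts such that, in each cell, the first nonzero of the three sums `α k i + β k j` is `1` if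
the pattern is true there, and is `-1` or `2`, hence neither `0` nor `1` modulo an odd prime, if it
is false. Row shifts in `{0, 1}` suffice, with column shifts in `{-1, 0, 1}`: any two patterns with
exactly one true entry, or any two with exactly one false entry, can be chosen so that some row
shifts handle every other pattern of a column (`exists_column_shift`). By the pigeonhole principle,
two such patterns can be found that do not occur among the three columns
(`exists_avoids_exceptional`).
-/

open scoped Matrix

/-! ### Sums of row and column shifts realizing a given 3 × 3 pattern -/

/-- The first nonzero entry of `v` is `1` when `b` is true, and is `-1` or `2` when `b` is false.
The integers `-1` and `2` are those whose residue lies outside `{0, 1}` modulo every odd prime. -/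
def FirstNonzeroIs (b : Bool) (v : Fin 3 → ℤ) : Prop :=
  ∃ k, (∀ l < k, v l = 0) ∧ if b then v k = 1 else v k = -1 ∨ v k = 2

instance (b : Bool) : DecidablePred (FirstNonzeroIs b) := fun v => by
  unfold FirstNonzeroIs; infer_instance

/-- Row shifts `k ↦ i ↦ rowShift b r k i` with values in `{0, 1}` that single out the row `r`. At
level `0` the shift is `1` on `r` alone (`b` true) or off `r` alone (`b` false); at level `1` it
separates the other two rows; at level `2` it vanishes. -/
def rowShift (b : Bool) (r : Fin 3) : Fin 3 → Fin 3 → ℤ :=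
  ![fun i => if decide (i = r) = b then 1 else 0, fun i => if i = r + 1 then 1 else 0, 0]

/-- The column pattern with value `b` in row `i` and `!b` in the other two rows. -/
def exceptional (b : Bool) (i : Fin 3) : Fin 3 → Bool := fun k => decide (k = i) == b

/-- With a shift `β ∈ {-1, 0, 1}` a level settles all rows of shift `0` as outside (`β = -1`), or all
rows of shift `1` as inside (`β = 0`), or every row by the negation of its shift (`β = 1`), and it
leaves the other rows to the next level. For the row shifts `rowShift b r`, only the patterns
`exceptional b i` with `i ≠ r` are not decision lists of this kind. -/
theorem exists_column_shift (b : Bool) (r : Fin 3) (s : Fin 3 → Bool)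
    (hs : ∀ i, i ≠ r → s ≠ exceptional b i) :
    ∃ β : Fin 3 → ℤ, ∀ i, FirstNonzeroIs (s i) fun k => rowShift b r k i + β k := by
  have key : ∀ (b : Bool) (r : Fin 3) (s : Fin 3 → Bool), (∀ i, i ≠ r → s ≠ exceptional b i) →
      ∃ β : Fin 3 → Fin 3, ∀ i,
        FirstNonzeroIs (s i) fun k => rowShift b r k i + ((β k : ℕ) - 1 : ℤ) := by
    decide +kernel
  obtain ⟨β, hβ⟩ := key b r s hs
  exact ⟨_, hβ⟩

/-- Among three columns, at most one has exactly one true entry or at most one has exactly one false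
entry. Take that kind for `b`, and the exceptional row of the column in question for `r`. -/
theorem exists_avoids_exceptional (s : Fin 3 → Fin 3 → Bool) :
    ∃ b r, ∀ j i, i ≠ r → s j ≠ exceptional b i := by
  revert s
  decide +kernel

/-- The row shifts depend on the whole pattern, but once they are fixed the columns are treated
independently of one another. -/
theorem exists_additive (s : Fin 3 → Fin 3 → Bool) :
    ∃ α β : Fin 3 → Fin 3 → ℤ, ∀ i j, FirstNonzeroIs (s i j) fun k => α k i + β k j := by
  obtain ⟨b, r, h⟩ := exists_avoids_exceptional fun j i => s i j
  choose β hβ using fun j => exists_column_shift b r _ (h j)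
  exact ⟨rowShift b r, fun k j => β j k, fun i j => hβ j i⟩


/-! ### Character sums over finite fields -/

theorem sum_addChar_dotProduct {F : Type*} [Field F] [Fintype F] {ι : Type*} [Fintype ι]
    [DecidableEq ι] {ψ : AddChar F ℂ} (hψ : ψ.IsPrimitive) {a : ι → F} (ha : a ≠ 0) :
    ∑ z : ι → F, ψ (a ⬝ᵥ z) = 0 := by
  let ℓ : (ι → F) →+ F := AddMonoidHom.mk' (fun z => a ⬝ᵥ z) fun x y => dotProduct_add a x y
  have hχ : ψ.compAddMonoidHom ℓ ≠ 0 := by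
    obtain ⟨i, hi⟩ := Function.ne_iff.1 ha
    obtain ⟨x, hx⟩ := AddChar.ne_one_iff.1 (hψ hi)
    refine AddChar.ne_zero_iff.2 ⟨Pi.single i x, ?_⟩
    simpa [ℓ, AddChar.mulShift_apply] using hx
  simpa [ℓ] using AddChar.sum_eq_zero_iff_ne_zero.2 hχ

/-- If every nontrivial character sum of `f` is smaller than the average size of a fibre, then `f` is
surjective: the number of solutions of `f x = v`, times the number of characters, is the trivial
character sum `card X` plus error terms of total size less than `card X`. -/
theorem exists_eq_of_norm_sum_addChar_lt {F : Type*} [Field F] [Fintype F] {ι : Type*} [Fintype ι]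
    {X : Type*} [Fintype X] [Nonempty X] {ψ : AddChar F ℂ} (hψ : ψ.IsPrimitive) (f : X → ι → F)
    (hf : ∀ μ : ι → F, μ ≠ 0 →
      ‖∑ x, ψ (μ ⬝ᵥ f x)‖ * (Fintype.card F : ℝ) ^ Fintype.card ι < Fintype.card X) (v : ι → F) :
    ∃ x, f x = v := by
  classical
  by_contra! hv
  set N : ℝ := (Fintype.card F : ℝ) ^ Fintype.card ι with hN
  have hN0 : 0 < N := by have := Fintype.card_pos (α := F); positivity
  have hX : (0 : ℝ) < Fintype.card X := by exact_mod_cast Fintype.card_pos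
  have hzero : ∑ μ : ι → F, ∑ x, ψ (μ ⬝ᵥ (f x - v)) = 0 := by
    rw [Finset.sum_comm]
    refine Finset.sum_eq_zero fun x _ => ?_
    simpa only [dotProduct_comm] using sum_addChar_dotProduct hψ (sub_ne_zero.2 (hv x))
  rw [← Finset.add_sum_erase _ _ (Finset.mem_univ 0)] at hzero
  have hnorm : ∀ μ : ι → F, μ ≠ 0 → ‖∑ x, ψ (μ ⬝ᵥ (f x - v))‖ ≤ Fintype.card X / N := by
    intro μ hμ
    have : ∑ x, ψ (μ ⬝ᵥ (f x - v)) = (∑ x, ψ (μ ⬝ᵥ f x)) * ψ (-(μ ⬝ᵥ v)) := by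
      simp only [dotProduct_sub, sub_eq_add_neg (μ ⬝ᵥ _), AddChar.map_add_eq_mul, Finset.sum_mul]
    rw [this, norm_mul, AddChar.norm_apply, mul_one, le_div_iff₀ hN0]
    exact (hf μ hμ).le
  have hrest : ‖∑ μ ∈ Finset.univ.erase (0 : ι → F), ∑ x, ψ (μ ⬝ᵥ (f x - v))‖ ≤
      (N - 1) * (Fintype.card X / N) := by
    refine (norm_sum_le_of_le _ fun μ hμ => hnorm μ (Finset.ne_of_mem_erase hμ)).trans ?_
    rw [Finset.sum_const, Finset.card_erase_of_mem (Finset.mem_univ _), nsmul_eq_mul,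
      Finset.card_univ, Fintype.card_fun, Nat.cast_sub (Nat.one_le_pow _ _ Fintype.card_pos)]
    simp [hN]
  rw [eq_neg_of_add_eq_zero_right hzero, norm_neg] at hrest
  simp only [zero_dotProduct, AddChar.map_zero_eq_one, Finset.sum_const, Finset.card_univ,
    nsmul_eq_mul, mul_one, Complex.norm_natCast] at hrest
  rw [sub_mul, mul_div_cancel₀ _ hN0.ne', one_mul] at hrest
  linarith [div_pos hX hN0]

/-- The absolute value of a Gauss sum of a nondegenerate quadratic form with a linear term. -/
theorem norm_sum_addChar_quadratic_sq {F : Type*} [Field F] [Fintype F] {n : ℕ} (h2 : (2 : F) ≠ 0)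
    {ψ : AddChar F ℂ} (hψ : ψ.IsPrimitive) {N : Matrix (Fin n) (Fin n) F} (hN : N.IsSymm)
    (hinj : ∀ v, N *ᵥ v = 0 → v = 0) (u : Fin n → F) :
    ‖∑ z, ψ (z ⬝ᵥ N *ᵥ z + u ⬝ᵥ z)‖ ^ 2 = (Fintype.card F : ℝ) ^ n := by
  classical
  have hsymm : ∀ z h, z ⬝ᵥ N *ᵥ h = h ⬝ᵥ N *ᵥ z := fun z h => by
    rw [Matrix.dotProduct_mulVec, ← Matrix.mulVec_transpose, hN.eq, dotProduct_comm]
  have hdiff : ∀ z h, ((h + z) ⬝ᵥ N *ᵥ (h + z) + u ⬝ᵥ (h + z)) + -(z ⬝ᵥ N *ᵥ z + u ⬝ᵥ z) =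
      (h ⬝ᵥ N *ᵥ h + u ⬝ᵥ h) + ((2 : F) • N *ᵥ h) ⬝ᵥ z := by
    intro z h
    rw [Matrix.mulVec_add, add_dotProduct, dotProduct_add, dotProduct_add, dotProduct_add,
      smul_dotProduct, dotProduct_comm (N *ᵥ h), hsymm h z, smul_eq_mul]
    ring
  have key : ((‖∑ z, ψ (z ⬝ᵥ N *ᵥ z + u ⬝ᵥ z)‖ ^ 2 : ℝ) : ℂ) = (Fintype.card F : ℂ) ^ n := by
    -- Substituting `y = h + z` in the double sum over `y, z` leaves a character sum over `z` that is
    -- linear, so that only `h = 0` contributes.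
    rw [Complex.ofReal_pow, ← Complex.mul_conj', map_sum, Finset.sum_mul_sum, Finset.sum_comm]
    have hshift : ∀ z : Fin n → F, ∑ y, ψ (y ⬝ᵥ N *ᵥ y + u ⬝ᵥ y) *
        (starRingEnd ℂ) (ψ (z ⬝ᵥ N *ᵥ z + u ⬝ᵥ z)) =
        ∑ h, ψ (h ⬝ᵥ N *ᵥ h + u ⬝ᵥ h) * ψ (((2 : F) • N *ᵥ h) ⬝ᵥ z) := by
      intro z
      rw [← Equiv.sum_comp (Equiv.addRight z : (Fin n → F) ≃ (Fin n → F))]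
      refine Finset.sum_congr rfl fun h _ => ?_
      rw [Equiv.coe_addRight, ← AddChar.map_neg_eq_conj, ← AddChar.map_add_eq_mul, hdiff,
        AddChar.map_add_eq_mul]
    rw [Finset.sum_congr rfl fun z _ => hshift z, Finset.sum_comm]
    simp only [← Finset.mul_sum]
    rw [Finset.sum_eq_single 0]
    · simp
    · intro h _ hh
      rw [sum_addChar_dotProduct hψ, mul_zero]
      exact smul_ne_zero h2 fun h0 => hh (hinj h h0)
    · simp
  exact_mod_cast key

/-! ### Pencils of nondegenerate symmetric matrices -/

/-- The linear combination of the matrices `T k` with coefficients `c k`. -/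
def pencil {F : Type*} [Field F] {m n : ℕ} (T : Fin m → Matrix (Fin n) (Fin n) F)
    (c : Fin m → F) : Matrix (Fin n) (Fin n) F :=
  ∑ k, c k • T k

/-- If every `v` orthogonal to all the `T k *ᵥ w i` violated the second condition, then a nonzero `c`
and a `C` as in that condition would determine `v`, since `pencil T c` is injective. There are too
few pairs `(c, C)` for that. -/
theorem exists_extend_isotropic {F : Type*} [Field F] [Fintype F] {m n t : ℕ}
    {T : Fin m → Matrix (Fin n) (Fin n) F} (hT : ∀ c ≠ 0, ∀ v, pencil T c *ᵥ v = 0 → v = 0)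
    (hn : m * (2 * t + 1) < n) (w : Fin t → Fin n → F) :
    ∃ v, (∀ i k, w i ⬝ᵥ T k *ᵥ v = 0) ∧
      ∀ c ≠ 0, ∀ C : Fin t → Fin m → F, pencil T c *ᵥ v ≠ ∑ i, pencil T (C i) *ᵥ w i := by
  classical
  by_contra! hbad
  let A : Matrix (Fin t × Fin m) (Fin n) F := Matrix.of fun p => w p.1 ᵥ* T p.2
  have hA : ∀ v : LinearMap.ker A.mulVecLin, ∃ x : (Fin m → F) × (Fin t → Fin m → F),
      x.1 ≠ 0 ∧ pencil T x.1 *ᵥ v.1 = ∑ i, pencil T (x.2 i) *ᵥ w i := by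
    rintro ⟨v, hv⟩
    obtain ⟨c, hc, C, h⟩ := hbad v fun i k => by
      rw [Matrix.dotProduct_mulVec]
      exact congrFun (LinearMap.mem_ker.1 hv) (i, k)
    exact ⟨(c, C), hc, h⟩
  choose g hg0 hg using hA
  have hginj : Function.Injective g := by
    intro v v' h
    refine Subtype.ext (sub_eq_zero.1 (hT _ (hg0 v) _ ?_))
    rw [Matrix.mulVec_sub, hg v, h, hg v', sub_self]
  have hcard := Fintype.card_le_of_injective g hginj
  rw [Module.card_eq_pow_finrank (K := F) (V := LinearMap.ker A.mulVecLin),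
    Module.card_eq_pow_finrank (K := F) (V := (Fin m → F) × (Fin t → Fin m → F)),
    Nat.pow_le_pow_iff_right Fintype.one_lt_card] at hcard
  have hrank := LinearMap.finrank_range_add_finrank_ker A.mulVecLin
  have hrange := Submodule.finrank_le (LinearMap.range A.mulVecLin)
  simp only [Module.finrank_prod, Module.finrank_pi_fintype, Module.finrank_self,
    mul_one, Finset.sum_const, Finset.card_univ, Fintype.card_fin,
    Fintype.card_prod, smul_eq_mul] at hcard hrank hrange
  have : m * (2 * t + 1) = t * m + (m + t * m) := by ring
  omega

/-- There are vectors `w i`, pairwise orthogonal for all the forms `T k`, such that all the vectors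
`T k *ᵥ w i` together are linearly independent (this is what the last condition says). -/
theorem exists_isotropic {F : Type*} [Field F] [Fintype F] {m n : ℕ}
    {T : Fin m → Matrix (Fin n) (Fin n) F} (hsymm : ∀ k, (T k).IsSymm)
    (hT : ∀ c ≠ 0, ∀ v, pencil T c *ᵥ v = 0 → v = 0) :
    ∀ t : ℕ, 2 * (m * t) < n + m → ∃ w : Fin t → Fin n → F,
      (∀ i j, i ≠ j → ∀ k, w i ⬝ᵥ T k *ᵥ w j = 0) ∧
      ∀ C : Fin t → Fin m → F, ∑ i, pencil T (C i) *ᵥ w i = 0 → C = 0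
  | 0, _ => ⟨0, fun i => i.elim0, fun _ _ => Subsingleton.elim _ _⟩
  | t + 1, hn => by
    have hn' : m * (2 * t + 1) < n := by
      have h : 2 * (m * (t + 1)) = m * (2 * t + 1) + m := by ring
      omega
    obtain ⟨w, hw, hind⟩ := exists_isotropic hsymm hT t (by rw [mul_add] at hn; omega)
    obtain ⟨v, hv, hv'⟩ := exists_extend_isotropic hT hn' w
    refine ⟨Fin.cons v w, fun i j hij k => ?_, fun C hC => ?_⟩
    · have hv_symm : ∀ i, v ⬝ᵥ T k *ᵥ w i = 0 := fun i => by
        rw [Matrix.dotProduct_mulVec, ← Matrix.mulVec_transpose, (hsymm k).eq, dotProduct_comm, hv]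
      induction i using Fin.cases with
      | zero =>
        induction j using Fin.cases with
        | zero => exact absurd rfl hij
        | succ j => exact hv_symm j
      | succ i =>
        induction j using Fin.cases with
        | zero => exact hv i k
        | succ j => exact hw i j (fun h => hij (congrArg _ h)) k
    · simp only [Fin.sum_univ_succ, Fin.cons_zero, Fin.cons_succ] at hC
      have h0 : C 0 = 0 := by
        by_contra h0
        refine hv' _ h0 (fun i => -C i.succ) ?_
        rw [eq_neg_of_add_eq_zero_left hC]
        simp [pencil, Matrix.neg_mulVec]
      have hsucc : (fun i : Fin t => C i.succ) = 0 := hind _ <| by simpa [h0, pencil] using hC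
      funext i
      induction i using Fin.cases with
      | zero => exact h0
      | succ i => exact congrFun hsucc i

/-- The linear conditions `w i ⬝ᵥ T k *ᵥ z = b i k` and the quadratic ones `z ⬝ᵥ T k *ᵥ z = a k` are
simultaneously solvable. A combination of the left-hand sides that involves a quadratic one is a
nondegenerate quadratic form plus a linear term, so its character sum is a Gauss sum of absolute
value `q ^ (n / 2)`; any other combination is a nonzero linear form, with character sum `0`. -/
theorem exists_bilin_eq_and_quad_eq {F : Type*} [Field F] [Fintype F] (h2 : (2 : F) ≠ 0)
    {ψ : AddChar F ℂ} (hψ : ψ.IsPrimitive) {m n t : ℕ}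
    {T : Fin m → Matrix (Fin n) (Fin n) F} (hsymm : ∀ k, (T k).IsSymm)
    (hT : ∀ c ≠ 0, ∀ v, pencil T c *ᵥ v = 0 → v = 0) (hn : 2 * (m * (t + 1)) < n)
    {w : Fin t → Fin n → F}
    (hw : ∀ C : Fin t → Fin m → F, ∑ i, pencil T (C i) *ᵥ w i = 0 → C = 0)
    (b : Fin t → Fin m → F) (a : Fin m → F) :
    ∃ z, (∀ i k, w i ⬝ᵥ T k *ᵥ z = b i k) ∧ ∀ k, z ⬝ᵥ T k *ᵥ z = a k := by
  classical
  let f : (Fin n → F) → (Fin t × Fin m) ⊕ Fin m → F := fun z =>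
    Sum.elim (fun p => w p.1 ⬝ᵥ T p.2 *ᵥ z) fun k => z ⬝ᵥ T k *ᵥ z
  have hpencil_symm : ∀ c, (pencil T c).IsSymm := fun c => by
    simp only [Matrix.IsSymm, pencil, Matrix.transpose_sum, Matrix.transpose_smul, (hsymm _).eq]
  have hpencil : ∀ (c : Fin m → F) x y,
      x ⬝ᵥ pencil T c *ᵥ y = ∑ k, c k * (x ⬝ᵥ T k *ᵥ y) := fun c x y => by
    simp only [pencil, Matrix.sum_mulVec, dotProduct_sum, Matrix.smul_mulVec, dotProduct_smul,
      smul_eq_mul]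
  have hsum : ∀ (μ : (Fin t × Fin m) ⊕ Fin m → F) z, μ ⬝ᵥ f z =
      z ⬝ᵥ pencil T (fun k => μ (.inr k)) *ᵥ z +
        (∑ i, pencil T (fun k => μ (.inl (i, k))) *ᵥ w i) ⬝ᵥ z := by
    intro μ z
    rw [hpencil, sum_dotProduct, dotProduct, Fintype.sum_sum_type, Fintype.sum_prod_type, add_comm]
    congr 1
    refine Finset.sum_congr rfl fun i _ => ?_
    rw [← Matrix.vecMul_transpose, (hpencil_symm _).eq, ← Matrix.dotProduct_mulVec, hpencil]
    rfl
  have hq : (1 : ℝ) < Fintype.card F := by exact_mod_cast Fintype.one_lt_card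
  have hf : ∀ μ : (Fin t × Fin m) ⊕ Fin m → F, μ ≠ 0 → ‖∑ z, ψ (μ ⬝ᵥ f z)‖ *
      (Fintype.card F : ℝ) ^ Fintype.card ((Fin t × Fin m) ⊕ Fin m) <
      Fintype.card (Fin n → F) := by
    intro μ hμ
    simp only [hsum, Fintype.card_sum, Fintype.card_prod, Fintype.card_fin, Fintype.card_fun,
      Nat.cast_pow]
    by_cases hc : (fun k => μ (.inr k)) = 0
    · have hC : ∑ i, pencil T (fun k => μ (.inl (i, k))) *ᵥ w i ≠ 0 := by
        intro h
        refine hμ (funext fun s => ?_)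
        rcases s with ⟨i, k⟩ | k
        · exact congrFun (congrFun (hw _ h) i) k
        · exact congrFun hc k
      have h0 : pencil T (0 : Fin m → F) = 0 := by simp [pencil]
      simp only [hc, h0, Matrix.zero_mulVec, dotProduct_zero, zero_add,
        sum_addChar_dotProduct hψ hC, norm_zero, zero_mul]
      positivity
    -- Squared, the bound needed is `q ^ n * q ^ (2 * (t * m + m)) < q ^ (2 * n)`.
    · refine lt_of_pow_lt_pow_left₀ 2 (by positivity) ?_
      rw [mul_pow, norm_sum_addChar_quadratic_sq h2 hψ (hpencil_symm _) (hT _ hc), ← pow_mul,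
        ← pow_add, ← pow_mul]
      refine pow_lt_pow_right₀ hq ?_
      have : 2 * (m * (t + 1)) = (t * m + m) * 2 := by ring
      omega
  obtain ⟨z, hz⟩ := exists_eq_of_norm_sum_addChar_lt hψ f hf (Sum.elim (fun p => b p.1 p.2) a)
  exact ⟨z, fun i k => congrFun hz (.inl (i, k)), fun k => congrFun hz (.inr k)⟩

/-! ### Quadratic Green-Sanders sets -/

theorem IsFullRankSymmBasis.eq_zero_of_pencil_mulVec_eq_zero {F : Type*} [Field F] {m n : ℕ}
    {M : Fin n → Matrix (Fin n) (Fin n) F} (hM : IsFullRankSymmBasis M) (e : Fin m ↪ Fin n)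
    (c : Fin m → F) (hc : c ≠ 0) (v : Fin n → F) (hv : pencil (fun k => M (e k)) c *ᵥ v = 0) :
    v = 0 := by
  have hne : pencil (fun k => M (e k)) c ≠ 0 := fun h =>
    hc (funext (Fintype.linearIndependent_iff.1 (hM.linearIndependent.comp e e.injective) c h))
  have hrank := hM.rank_eq _ (Submodule.sum_mem _ fun k _ => Submodule.smul_mem _ _
    (Submodule.subset_span (Set.mem_range_self (e k)))) hne
  have hadd := LinearMap.finrank_range_add_finrank_ker (pencil (fun k => M (e k)) c).mulVecLin
  rw [← Matrix.rank, pencil, hrank, Module.finrank_fintype_fun_eq_card, Fintype.card_fin,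
    Nat.add_eq_left, Submodule.finrank_eq_zero] at hadd
  exact (Submodule.mem_bot F).1 (hadd ▸ LinearMap.mem_ker.2 hv)

theorem quadVal_add_add {F : Type*} [Field F] {n : ℕ} {N : Matrix (Fin n) (Fin n) F}
    (hN : N.IsSymm) (x y z : Fin n → F) :
    quadVal N (x + y + z) = quadVal N z + (quadVal N x + 2 * (x ⬝ᵥ N *ᵥ z)) +
      (quadVal N y + 2 * (y ⬝ᵥ N *ᵥ z)) + 2 * (x ⬝ᵥ N *ᵥ y) := by
  have hsymm : ∀ u v, u ⬝ᵥ N *ᵥ v = v ⬝ᵥ N *ᵥ u := fun u v => by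
    rw [Matrix.dotProduct_mulVec, ← Matrix.mulVec_transpose, hN.eq, dotProduct_comm]
  simp only [quadVal, Matrix.mulVec_add, add_dotProduct, dotProduct_add]
  rw [hsymm y x, hsymm z x, hsymm z y]
  ring

/-- If the first three forms take the values `v k` at `x` and these are not all zero, then they
decide whether `x` belongs to `QGS M`. -/
theorem mem_QGS_iff_of_firstNonzeroIs {F : Type*} [Field F] (h2 : (2 : F) ≠ 0) {n : ℕ}
    (hn : 3 ≤ n) {M : Fin n → Matrix (Fin n) (Fin n) F} {x : Fin n → F} {b : Bool}
    {v : Fin 3 → ℤ} (hv : FirstNonzeroIs b v)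
    (hx : ∀ k, quadVal (M (Fin.castLE hn k)) x = v k) : x ∈ QGS M ↔ b = true := by
  obtain ⟨k, hlt, hk⟩ := hv
  have hzero : ∀ i, i < Fin.castLE hn k → quadVal (M i) x = 0 := by
    intro i hi
    have h := hx ⟨i, (Fin.lt_def.1 hi).trans k.2⟩
    rwa [hlt _ hi, Int.cast_zero] at h
  cases b with
  | true => exact iff_of_true ⟨_, hzero, by rw [hx, show v k = 1 from hk, Int.cast_one]⟩ rfl
  | false =>
    have hk' : quadVal (M (Fin.castLE hn k)) x ≠ 0 ∧ quadVal (M (Fin.castLE hn k)) x ≠ 1 := by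
      have hk : v k = -1 ∨ v k = 2 := hk
      rw [hx]
      rcases hk with hk | hk <;> rw [hk] <;> push_cast
      · refine ⟨by simp, fun h => h2 ?_⟩
        linear_combination -h
      · exact ⟨h2, fun h => one_ne_zero (α := F) (by linear_combination h)⟩
    refine iff_of_false ?_ Bool.false_ne_true
    rintro ⟨i, hi, hi1⟩
    rcases lt_trichotomy i (Fin.castLE hn k) with h | rfl | h
    · exact zero_ne_one ((hzero i h).symm.trans hi1)
    · exact hk'.2 hi1
    · exact hk'.1 (hi _ h)

/-- Fixed `x` and `y` such that the values of the forms at the nine points `x i + y j + z` can be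
prescribed, through the choice of `z`, to be any sums of row and column shifts. -/
theorem exists_quadVal_add_eq {F : Type*} [Field F] [Fintype F] (h2 : (2 : F) ≠ 0)
    {ψ : AddChar F ℂ} (hψ : ψ.IsPrimitive) {m n : ℕ} {T : Fin m → Matrix (Fin n) (Fin n) F}
    (hsymm : ∀ k, (T k).IsSymm) (hT : ∀ c ≠ 0, ∀ v, pencil T c *ᵥ v = 0 → v = 0)
    (hn : 10 * m < n) :
    ∃ x y : Fin 3 → Fin n → F, ∀ α β : Fin m → Fin 3 → F, ∃ z, ∀ i j k,
      quadVal (T k) (x i + y j + z) = α k i + β k j := by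
  obtain ⟨w, hw, hind⟩ := exists_isotropic hsymm hT 4 (by omega)
  refine ⟨![0, w 0, w 1], ![0, w 2, w 3], fun α β => ?_⟩
  -- By orthogonality of `x i` and `y j`, the value at `x i + y j + z` is the value at `z` plus a term
  -- in `i` and a term in `j`; `b` lists the increments of these terms over index `0`.
  let b : Fin 4 → Fin m → F := ![
    fun k => α k 1 - α k 0, fun k => α k 2 - α k 0, fun k => β k 1 - β k 0, fun k => β k 2 - β k 0]
  obtain ⟨z, hz, hz'⟩ := exists_bilin_eq_and_quad_eq h2 hψ hsymm hT (by omega) hind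
    (fun i k => (b i k - quadVal (T k) (w i)) / 2) fun k => α k 0 + β k 0
  have hlin : ∀ i k, quadVal (T k) (w i) + 2 * (w i ⬝ᵥ T k *ᵥ z) = b i k := fun i k => by
    rw [hz]
    field_simp
    ring
  have h0 : ∀ k, quadVal (T k) 0 = 0 := fun k => by simp [quadVal]
  refine ⟨z, fun i j k => ?_⟩
  rw [quadVal_add_add (hsymm k), show quadVal (T k) z = α k 0 + β k 0 from hz' k]
  have hx : quadVal (T k) ((![0, w 0, w 1] : Fin 3 → Fin n → F) i) +
      2 * ((![0, w 0, w 1] : Fin 3 → Fin n → F) i ⬝ᵥ T k *ᵥ z) = α k i - α k 0 := by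
    fin_cases i
    · simp [h0]
    · exact hlin 0 k
    · exact hlin 1 k
  have hy : quadVal (T k) ((![0, w 2, w 3] : Fin 3 → Fin n → F) j) +
      2 * ((![0, w 2, w 3] : Fin 3 → Fin n → F) j ⬝ᵥ T k *ᵥ z) = β k j - β k 0 := by
    fin_cases j
    · simp [h0]
    · exact hlin 2 k
    · exact hlin 3 k
  have hxy : (![0, w 0, w 1] : Fin 3 → Fin n → F) i ⬝ᵥ
      T k *ᵥ (![0, w 2, w 3] : Fin 3 → Fin n → F) j = 0 := by
    fin_cases i <;> fin_cases j <;> simp [hw]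
  rw [hx, hy, hxy]
  ring

theorem theorem1p7 (p : ℕ) [Fact p.Prime] (hp : 2 < p) (n : ℕ) (hn : 31 ≤ n)
    (M : Fin n → Matrix (Fin n) (Fin n) (ZMod p)) (hM : IsFullRankSymmBasis M) :
    VC2DimAtLeast (QGS M) 3 := by
  classical
  have h2 : (2 : ZMod p) ≠ 0 := Ring.two_ne_zero (by rw [ZMod.ringChar_zmod_n]; omega)
  have hn3 : 3 ≤ n := by omega
  obtain ⟨x, y, hxy⟩ := exists_quadVal_add_eq h2 (ZMod.isPrimitive_stdAddChar p)
    (fun k : Fin 3 => hM.isSymm (Fin.castLE hn3 k))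
    (hM.eq_zero_of_pencil_mulVec_eq_zero (Fin.castLEEmb hn3)) (by omega)
  choose α β hαβ using exists_additive
  choose z hz using hxy
  let s : Set (Fin 3 × Fin 3) → Fin 3 → Fin 3 → Bool := fun S i j => decide ((i, j) ∈ S)
  refine ⟨x, y, fun S => z (fun k i => α (s S) k i) fun k j => β (s S) k j, fun S i j => ?_⟩
  rw [mem_QGS_iff_of_firstNonzeroIs h2 hn3 (hαβ (s S) i j) fun k => by rw [hz]; push_cast; rfl]
  exact decide_eq_true_iff
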